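/- All graphs are finite and simple; $\chi(G)$ and $\omega(G)$ denote the chromatic number and the clique number of $G$. A graph $G$ is $H$-free if no induced subgraph of $G$ is isomorphic to $H$, and the $H$-free subclass of a class $\mathcal G$ of graphs consists of all $H$-free members of $\mathcal G$. A class of graphs (closed under isomorphism) is hereditary if it is closed under taking induced subgraphs. A hereditary class $\mathcal G$ is $\chi$-bounded if there is a function $f\colon\mathbb N\to\mathbb R_{\ge 0}$ with $\chi(G)\le f(\omega(G))$ for all $G\in\mathcal G$, and it is linearly $\chi$-bounded if there is a constant $C=C(\mathcal G)\ge 1$ with $\chi(G)\le C\cdot\omega(G)$ for all $G\in\mathcal G$. **Proposition.** Let $H$ be a graph such that for every $\chi$-bounded hereditary class $\mathcal G$, the $H$-free subclass of $\mathcal G$ is linearly $\chi$-bounded. Then the complement $\overline H$ of $H$ is a $P_5$-free forest, that is, $\overline H$ has no cycle and has no induced subgraph isomorphic to the path $P_5$ on five vertices. -/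

import Mathlib

open scoped SimpleGraph NNReal

/-- A finite simple graph. -/
structure FinGraph : Type 1 where
  /-- The vertex set. -/
  V : Type
  [finite : Finite V]
  /-- The adjacency structure. -/
  graph : SimpleGraph V

attribute [instance] FinGraph.finite

namespace FinGraph

/-- The chromatic number of a finite graph, as a natural number. -/
noncomputable def chi (G : FinGraph) : ℕ := G.graph.chromaticNumber.toNat

/-- The clique number of a finite graph. -/
noncomputable def omega (G : FinGraph) : ℕ := G.graph.cliqueNum

/-- No truncation happens in `chi`: a finite graph has finite chromatic number. -/
theorem coe_chi (G : FinGraph) : (G.chi : ℕ∞) = G.graph.chromaticNumber := by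
  classical
  have := Fintype.ofFinite G.V
  exact ENat.natCast_toNat
    (SimpleGraph.chromaticNumber_ne_top_iff_exists.mpr ⟨_, G.graph.colorable_of_fintype⟩)

end FinGraph

/-- `G` is `H`-free: no induced subgraph of `G` is isomorphic to `H`. -/
def IsFreeOf {V W : Type*} (H : SimpleGraph W) (G : SimpleGraph V) : Prop := ¬ H ⊴ G

/-- A class of finite graphs is hereditary if it is closed under taking induced subgraphs
(up to isomorphism, as graph classes are closed under isomorphism). -/
def IsHereditary (𝒢 : Set FinGraph) : Prop :=
  ∀ G ∈ 𝒢, ∀ F : FinGraph, F.graph ⊴ G.graph → F ∈ 𝒢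

/-- `f` is a `χ`-binding function for the class `𝒢`. -/
def IsChiBinding (𝒢 : Set FinGraph) (f : ℕ → ℝ≥0) : Prop :=
  ∀ G ∈ 𝒢, (G.chi : ℝ≥0) ≤ f G.omega

/-- The class `𝒢` has a `χ`-binding function. -/
def IsChiBounded (𝒢 : Set FinGraph) : Prop :=
  ∃ f : ℕ → ℝ≥0, IsChiBinding 𝒢 f

/-- The class `𝒢` has a linear `χ`-binding function `n ↦ C * n` with `C ≥ 1`. -/
def IsLinearlyChiBounded (𝒢 : Set FinGraph) : Prop :=
  ∃ C : ℝ≥0, 1 ≤ C ∧ IsChiBinding 𝒢 (fun n => C * n)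

/-- The `H`-free subclass of the class `𝒢`. -/
def freeSubclass {W : Type*} (H : SimpleGraph W) (𝒢 : Set FinGraph) : Set FinGraph :=
  {G | G ∈ 𝒢 ∧ IsFreeOf H G.graph}

/-!
Two hereditary `χ`-bounded classes suffice, one for each half of the conclusion.

*Cycles.* The finite graphs with independence number at most two form a `χ`-bounded class by Ramsey's
theorem for triangles (`CliqueFree.card_le_indepNum_add_sq`). A member `Jᶜ`, with `J`
triangle-free, has `χ(Jᶜ) ≥ |J| / 2` since color classes have at most two vertices, and
`ω(Jᶜ) = α(J)`. If `Hᶜ` contains a cycle and `J` has no cycle of that length, then `Jᶜ` is `H`-free.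
So a linear bound contradicts Erdős's theorem that there are graphs without short cycles for which
`α(J) / |J|` is arbitrarily small (`exists_cycleGraph_free_mul_indepNum_lt`). That theorem is proved
by the first moment method, a random graph being a uniformly random labelling of the pairs of
vertices by `q + 1` labels, with the pairs of label `0` as edges: expectations become sums over all
labellings.

*Induced paths.* Consider the induced subgraphs of the iterated lexicographic powers of the
five-cycle. If such a graph has clique number `n`, a copy of the previous power in which it has a
clique of size `n` is adjacent to no other copy that it meets. In each of the remaining copies its
clique number is less than `n`; as the five-cycle is 3-colorable, `χ ≤ 3 ^ n` follows by induction
(`colorable_lexProd_of_cliqueFreeOn`). The path `P₅` is prime, so it is not induced in the complement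
of any of these powers, as it is not induced in the complement of the five-cycle
(`pathGraph_five_isIndContained_of_lexProd`). If `P₅` is induced in `Hᶜ`, all of the powers are
therefore `H`-free. The `k`-th power has `5 ^ k` vertices, while its clique number and its
independence number are at most `2 ^ k`, so that `χ / ω ≥ (5 / 4) ^ k` is unbounded.
-/

namespace SimpleGraph

variable {V W : Type*}

/-! ### Bounds on the order and the chromatic number -/

theorem Colorable.card_le_mul_indepNum [Finite V] {G : SimpleGraph V} {n : ℕ}
    (h : G.Colorable n) : Nat.card V ≤ n * G.indepNum := by
  classical
  have := Fintype.ofFinite V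
  obtain ⟨c⟩ := h
  have h1 := Finset.card_le_mul_card_image (f := c) Finset.univ G.indepNum fun b _ =>
    IsIndepSet.card_le_indepNum (G := G) (by
      simpa [Coloring.colorClass] using c.isIndepSet_colorClass b)
  have h2 : (Finset.univ.image c).card ≤ n := by
    simpa using Finset.card_le_univ (Finset.univ.image c)
  rw [Nat.card_eq_fintype_card, mul_comm]
  exact h1.trans (Nat.mul_le_mul_left _ h2)

/-- The bound `R(3, a + 1) ≤ a + a² + 1`: a maximum independent set dominates the graph, and in a
triangle-free graph all neighbourhoods are independent. -/
theorem CliqueFree.card_le_indepNum_add_sq [Finite V] {G : SimpleGraph V}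
    (h : G.CliqueFree 3) : Nat.card V ≤ G.indepNum + G.indepNum * G.indepNum := by
  classical
  have := Fintype.ofFinite V
  obtain ⟨s, hs⟩ := G.exists_isNIndepSet_indepNum
  have hcover : (Finset.univ : Finset V) ⊆ s ∪ s.biUnion fun v => G.neighborFinset v := by
    intro x _
    by_contra hx
    simp only [Finset.mem_union, Finset.mem_biUnion, mem_neighborFinset, not_or, not_exists,
      not_and] at hx
    have hind : G.IsIndepSet (insert x s : Finset V) := by
      rw [Finset.coe_insert, isIndepSet_iff, Set.pairwise_insert]
      exact ⟨hs.isIndepSet, fun b hb _ => ⟨fun hxb => hx.2 b hb hxb.symm, hx.2 b hb⟩⟩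
    have := hind.card_le_indepNum
    rw [Finset.card_insert_of_notMem hx.1, hs.card_eq] at this
    omega
  calc Nat.card V = (Finset.univ : Finset V).card := by simp
    _ ≤ _ := Finset.card_le_card hcover
    _ ≤ _ := Finset.card_union_le _ _
    _ ≤ G.indepNum + G.indepNum * G.indepNum := by
      gcongr
      · exact hs.card_eq.le
      · refine (Finset.card_biUnion_le_card_mul _ _ G.indepNum fun v _ => ?_).trans
          (Nat.mul_le_mul_right _ hs.card_eq.le)
        exact IsIndepSet.card_le_indepNum
          (by simpa using G.isIndepSet_neighborSet_of_triangleFree h v)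

/-! ### Lexicographic products -/

/-- The lexicographic product: every vertex of `G` is replaced by a copy of `H`, and copies
belonging to adjacent vertices of `G` are completely joined. -/
def lexProd (G : SimpleGraph V) (H : SimpleGraph W) : SimpleGraph (V × W) where
  Adj x y := G.Adj x.1 y.1 ∨ x.1 = y.1 ∧ H.Adj x.2 y.2
  symm := ⟨fun _ _ h => h.imp (fun h => h.symm) fun h => ⟨h.1.symm, h.2.symm⟩⟩
  loopless := ⟨fun _ h => h.elim G.irrefl fun h => H.irrefl h.2⟩

theorem lexProd_adj {G : SimpleGraph V} {H : SimpleGraph W} {x y : V × W} :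
    (G.lexProd H).Adj x y ↔ G.Adj x.1 y.1 ∨ x.1 = y.1 ∧ H.Adj x.2 y.2 := Iff.rfl

theorem compl_lexProd (G : SimpleGraph V) (H : SimpleGraph W) :
    (G.lexProd H)ᶜ = Gᶜ.lexProd Hᶜ := by
  ext ⟨a, b⟩ ⟨c, d⟩
  simp only [compl_adj, lexProd_adj, Prod.mk.injEq, ne_eq]
  by_cases hac : a = c
  · subst hac; simp
  · simp [hac]

theorem cliqueNum_lexProd_le [Finite V] [Finite W] (G : SimpleGraph V) (H : SimpleGraph W) :
    (G.lexProd H).cliqueNum ≤ G.cliqueNum * H.cliqueNum := by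
  classical
  obtain ⟨s, hs, hcard⟩ := (G.lexProd H).exists_isNClique_cliqueNum
  have hfib : ∀ a ∈ s.image Prod.fst, {x ∈ s | x.1 = a}.card ≤ H.cliqueNum := by
    intro a _
    rw [← Finset.card_image_of_injOn (f := Prod.snd)]
    · refine IsClique.card_le_cliqueNum (tc := ?_)
      rintro _ hb _ hb' hne
      simp only [Finset.coe_image, Set.mem_image, Finset.mem_coe, Finset.mem_filter] at hb hb'
      obtain ⟨x, ⟨hx, rfl⟩, rfl⟩ := hb
      obtain ⟨y, ⟨hy, hyx⟩, rfl⟩ := hb'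
      have := lexProd_adj.1 (hs hx hy (by rintro rfl; exact hne rfl))
      simpa [hyx] using this
    · intro x hx y hy hxy
      simp only [Finset.coe_filter, Set.mem_ofPred_eq] at hx hy
      exact Prod.ext (hx.2.trans hy.2.symm) hxy
  have himg : (s.image Prod.fst).card ≤ G.cliqueNum := by
    refine IsClique.card_le_cliqueNum (tc := ?_)
    rintro _ ha _ ha' hne
    simp only [Finset.coe_image, Set.mem_image, Finset.mem_coe] at ha ha'
    obtain ⟨x, hx, rfl⟩ := ha
    obtain ⟨y, hy, rfl⟩ := ha'
    have := lexProd_adj.1 (hs hx hy (by rintro rfl; exact hne rfl))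
    simpa [hne] using this
  rw [← hcard, mul_comm]
  exact (Finset.card_le_mul_card_image s _ hfib).trans (Nat.mul_le_mul_left _ himg)

theorem indepNum_lexProd_le [Finite V] [Finite W] (G : SimpleGraph V) (H : SimpleGraph W) :
    (G.lexProd H).indepNum ≤ G.indepNum * H.indepNum := by
  simpa only [← cliqueNum_compl, compl_lexProd] using cliqueNum_lexProd_le Gᶜ Hᶜ

/-- The path on five vertices is prime: the vertices of an induced copy in a lexicographic product
that lie over the same vertex of the first factor form a module, hence the copy either projects
injectively to the first factor or lies inside a copy of the second. -/
theorem pathGraph_five_isIndContained_of_lexProd {G : SimpleGraph V} {H : SimpleGraph W}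
    (h : pathGraph 5 ⊴ G.lexProd H) : pathGraph 5 ⊴ G ∨ pathGraph 5 ⊴ H := by
  obtain ⟨f⟩ := h
  -- A vertex outside a fibre of the projection is adjacent to all or none of that fibre.
  have hmod : ∀ i j k, (f i).1 = (f j).1 → (f k).1 ≠ (f i).1 →
      ((pathGraph 5).Adj k i ↔ (pathGraph 5).Adj k j) := by
    intro i j k hij hki
    have hkj : (f k).1 ≠ (f j).1 := hij ▸ hki
    rw [← f.map_adj_iff, ← f.map_adj_iff, lexProd_adj, lexProd_adj]
    simp [hkj, hij]
  have hprime : Function.Injective (fun i => (f i).1) ∨ ∀ i j, (f i).1 = (f j).1 := by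
    have hmod' : ∀ i j k, ¬ ((pathGraph 5).Adj k i ↔ (pathGraph 5).Adj k j) →
        (f i).1 = (f j).1 → (f k).1 = (f i).1 :=
      fun i j k hk hij => by_contra fun hki => hk (hmod i j k hij hki)
    simp only [pathGraph_adj] at hmod'
    have h01 := hmod' 0 1 2 (by decide)
    have h02 := hmod' 0 2 3 (by decide)
    have h03 := hmod' 0 3 1 (by decide)
    have h03' := hmod' 0 3 4 (by decide)
    have h04 := hmod' 0 4 1 (by decide)
    have h12 := hmod' 1 2 0 (by decide)
    have h12' := hmod' 1 2 3 (by decide)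
    have h13 := hmod' 1 3 0 (by decide)
    have h14 := hmod' 1 4 0 (by decide)
    have h23 := hmod' 2 3 1 (by decide)
    have h24 := hmod' 2 4 1 (by decide)
    have h34 := hmod' 3 4 2 (by decide)
    rw [or_iff_not_imp_left]
    intro hinj
    have hall : (f 1).1 = (f 0).1 ∧ (f 2).1 = (f 0).1 ∧ (f 3).1 = (f 0).1 ∧
        (f 4).1 = (f 0).1 := by
      simp only [Function.Injective, not_forall] at hinj
      obtain ⟨i, j, hij, hne⟩ := hinj
      clear hmod hmod'
      fin_cases i <;> fin_cases j <;> simp at hij hne <;> grind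
    have h0 : ∀ i, (f i).1 = (f 0).1 := by
      intro i
      fin_cases i
      exacts [rfl, hall.1, hall.2.1, hall.2.2.1, hall.2.2.2]
    exact fun i j => (h0 i).trans (h0 j).symm
  rcases hprime with hinj | hconst
  · refine .inl ⟨⟨⟨fun i => (f i).1, hinj⟩, fun {i j} => ?_⟩⟩
    rw [← f.map_adj_iff, lexProd_adj]
    change G.Adj (f i).1 (f j).1 ↔ _
    by_cases hij : i = j
    · subst hij; simp
    · have : (f i).1 ≠ (f j).1 := fun h => hij (hinj h)
      simp [this]
  · refine .inr ⟨⟨⟨fun i => (f i).2, fun i j hij => f.injective (Prod.ext (hconst i j) hij)⟩,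
      fun {i j} => ?_⟩⟩
    rw [← f.map_adj_iff, lexProd_adj]
    change H.Adj (f i).2 (f j).2 ↔ _
    simp [hconst i j]

/-- If, for all `n`, every induced subgraph of `H` without cliques of size `n + 1` is
`3 ^ n`-colorable, then the same is true of `G.lexProd H` for every 3-colorable graph `G`.
Induced subgraphs are given by their vertex sets `s`, and colorings by functions that are proper
on `s`. -/
theorem colorable_lexProd_of_cliqueFreeOn {G : SimpleGraph V} {H : SimpleGraph W}
    (hG : G.Colorable 3)
    (hH : ∀ (s : Set W) (n : ℕ), H.CliqueFreeOn s (n + 1) →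
      ∃ c : W → Fin (3 ^ n), ∀ x ∈ s, ∀ y ∈ s, H.Adj x y → c x ≠ c y)
    (s : Set (V × W)) (n : ℕ) (hs : (G.lexProd H).CliqueFreeOn s (n + 1)) :
    ∃ c : V × W → Fin (3 ^ n), ∀ x ∈ s, ∀ y ∈ s, (G.lexProd H).Adj x y → c x ≠ c y := by
  classical
  obtain ⟨c₀⟩ := hG
  -- The fibre of `s` over `a`.
  let F (a : V) : Set W := {w | (a, w) ∈ s}
  have hlift : ∀ a (t : Finset W) m, H.IsNClique m t → (t : Set W) ⊆ F a →
      (G.lexProd H).IsNClique m (t.image (Prod.mk a)) ∧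
        ((t.image (Prod.mk a) : Finset (V × W)) : Set (V × W)) ⊆ s := by
    intro a t m ht hta
    refine ⟨⟨?_, ?_⟩, ?_⟩
    · rintro _ hx _ hy hne
      simp only [Finset.coe_image, Set.mem_image, Finset.mem_coe] at hx hy
      obtain ⟨x, hx, rfl⟩ := hx
      obtain ⟨y, hy, rfl⟩ := hy
      exact lexProd_adj.2 (.inr ⟨rfl, ht.isClique hx hy (by rintro rfl; exact hne rfl)⟩)
    · rw [Finset.card_image_of_injective _ (Prod.mk_right_injective a), ht.card_eq]
    · rintro _ hx
      simp only [Finset.coe_image, Set.mem_image, Finset.mem_coe] at hx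
      obtain ⟨x, hx, rfl⟩ := hx
      exact hta hx
  have hF : ∀ a, H.CliqueFreeOn (F a) (n + 1) := fun a t hta ht =>
    hs (hlift a t _ ht hta).2 (hlift a t _ ht hta).1
  cases n with
  | zero =>
    have hempty : ∀ x, x ∉ s := fun x hx =>
      hs (t := {x}) (by simpa using hx) (by simp [isNClique_iff])
    exact ⟨fun _ => 0, fun x hx => (hempty x hx).elim⟩
  | succ n =>
    choose c hc using fun a => hH (F a) (n + 1) (hF a)
    have hd : ∀ a, ∃ d : W → Fin (3 ^ n), H.CliqueFreeOn (F a) (n + 1) →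
        ∀ x ∈ F a, ∀ y ∈ F a, H.Adj x y → d x ≠ d y := by
      intro a
      by_cases h : H.CliqueFreeOn (F a) (n + 1)
      · obtain ⟨d, hd⟩ := hH (F a) n h
        exact ⟨d, fun _ => hd⟩
      · exact ⟨fun _ => ⟨0, by positivity⟩, fun h' => (h h').elim⟩
    choose d hd using hd
    let e : Fin 3 × Fin (3 ^ n) ≃ Fin (3 ^ (n + 1)) :=
      finProdFinEquiv.trans (finCongr (by rw [pow_succ, mul_comm]))
    -- A fibre with a clique of the maximum size has only empty fibres around it.
    have hmax : ∀ a b, ¬ H.CliqueFreeOn (F a) (n + 1) → G.Adj a b → ∀ w, (b, w) ∉ s := by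
      intro a b ha hab w hw
      simp only [CliqueFreeOn, not_forall, not_not] at ha
      obtain ⟨t, hta, ht⟩ := ha
      obtain ⟨h1, h2⟩ := hlift a t _ ht hta
      refine hs (t := insert (b, w) (t.image (Prod.mk a))) ?_ (h1.insert ?_)
      · rw [Finset.coe_insert]
        exact Set.insert_subset hw h2
      · intro x hx
        simp only [Finset.mem_image] at hx
        obtain ⟨x, -, rfl⟩ := hx
        exact lexProd_adj.2 (.inl hab.symm)
    refine ⟨fun x => if H.CliqueFreeOn (F x.1) (n + 1) then e (c₀ x.1, d x.1 x.2) else c x.1 x.2,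
      ?_⟩
    rintro ⟨a, x⟩ hx ⟨b, y⟩ hy hadj
    rcases lexProd_adj.1 hadj with hab | ⟨rfl, hxy⟩
    · have ha : H.CliqueFreeOn (F a) (n + 1) := by
        by_contra h; exact hmax a b h hab y hy
      have hb : H.CliqueFreeOn (F b) (n + 1) := by
        by_contra h; exact hmax b a h hab.symm x hx
      simp only [ha, hb, if_true]
      exact fun h => c₀.valid hab (congrArg Prod.fst (e.injective h))
    · dsimp only at hxy ⊢
      split_ifs with ha
      · exact fun h => hd a ha x hx y hy hxy (congrArg Prod.snd (e.injective h))
      · exact hc a x hx y hy hxy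

/-! ### Sparse graphs with small independence number -/

theorem card_filter_forall_mem_mul_pow {ι β : Type*} [Fintype ι] [DecidableEq ι] [Fintype β]
    [DecidableEq β] (A : Finset ι) (T : Finset β) :
    (Finset.univ.filter fun f : ι → β => ∀ i ∈ A, f i ∈ T).card * Fintype.card β ^ A.card =
      T.card ^ A.card * Fintype.card β ^ Fintype.card ι := by
  have h : (Finset.univ.filter fun f : ι → β => ∀ i ∈ A, f i ∈ T) =
      Fintype.piFinset fun i => if i ∈ A then T else Finset.univ := by
    ext f
    simp only [Finset.mem_filter, Finset.mem_univ, true_and, Fintype.mem_piFinset]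
    refine forall_congr' fun i => ?_
    split_ifs with hi <;> simp [hi]
  have h2 : ∏ i, (if i ∈ A then T else Finset.univ).card =
      T.card ^ A.card * Fintype.card β ^ Aᶜ.card := by
    simp only [apply_ite Finset.card, Finset.card_univ, Finset.prod_ite, Finset.prod_const]
    congr 3 <;> ext <;> simp
  rw [h, Fintype.card_piFinset, h2, mul_assoc, ← pow_add, add_comm, Finset.card_add_card_compl]

section RandomGraph

variable {X : Type*} {q : ℕ}

/-- The graph on `X` whose edges are the pairs that receive label `0`. A uniformly random labelling
`f` by `q + 1` labels gives the binomial random graph with edge probability `1 / (q + 1)`. -/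
def zeroLabelGraph (f : Sym2 X → Fin (q + 1)) : SimpleGraph X := fromEdgeSet {e | f e = 0}

theorem zeroLabelGraph_adj {f : Sym2 X → Fin (q + 1)} {x y : X} :
    (zeroLabelGraph f).Adj x y ↔ f s(x, y) = 0 ∧ x ≠ y := by
  simp [zeroLabelGraph]

variable [Fintype X] [DecidableEq X]

theorem card_edgeFinset_cycleGraph (m : ℕ) : (cycleGraph (m + 3)).edgeFinset.card = m + 3 := by
  have := sum_degrees_eq_twice_card_edges (cycleGraph (m + 3))
  simp only [cycleGraph_degree_three_le, Finset.sum_const, Finset.card_univ, Fintype.card_fin,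
    smul_eq_mul] at this
  omega

/-- The total number of copies of the cycle of length `m + 3` in all labelled graphs: as the cycle
has as many edges as vertices, the expected number is at most `(|X| / (q + 1)) ^ (m + 3)`. -/
theorem card_cycleGraph_copies_le (d m : ℕ) (hX : Fintype.card X = d * (q + 1)) :
    ∑ f : Sym2 X → Fin (q + 1), (Finset.univ.filter fun φ : Fin (m + 3) ↪ X =>
        ∀ i j, (cycleGraph (m + 3)).Adj i j → f s(φ i, φ j) = 0).card ≤
      d ^ (m + 3) * (q + 1) ^ Fintype.card (Sym2 X) := by
  have hcount : ∀ φ : Fin (m + 3) ↪ X,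
      (Finset.univ.filter fun f : Sym2 X → Fin (q + 1) =>
        ∀ i j, (cycleGraph (m + 3)).Adj i j → f s(φ i, φ j) = 0).card * (q + 1) ^ (m + 3) =
      (q + 1) ^ Fintype.card (Sym2 X) := by
    intro φ
    have h := card_filter_forall_mem_mul_pow
      ((cycleGraph (m + 3)).edgeFinset.map φ.sym2Map) ({0} : Finset (Fin (q + 1)))
    rw [Finset.card_map, card_edgeFinset_cycleGraph, Fintype.card_fin, Finset.card_singleton,
      one_pow, one_mul] at h
    rw [← h]
    congr 2
    ext f
    simp only [Finset.mem_filter, Finset.mem_univ, true_and, Finset.forall_mem_map,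
      Finset.mem_singleton, Sym2.forall, mem_edgeFinset, mem_edgeSet,
      Function.Embedding.sym2Map_apply, Sym2.map_mk]
  have hswap := Finset.sum_card_bipartiteAbove_eq_sum_card_bipartiteBelow
    (fun (f : Sym2 X → Fin (q + 1)) (φ : Fin (m + 3) ↪ X) =>
      ∀ i j, (cycleGraph (m + 3)).Adj i j → f s(φ i, φ j) = 0)
    (s := Finset.univ) (t := Finset.univ)
  simp only [Finset.bipartiteAbove, Finset.bipartiteBelow] at hswap
  rw [hswap]
  refine Nat.le_of_mul_le_mul_right (c := (q + 1) ^ (m + 3)) ?_ (by positivity)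
  rw [Finset.sum_mul, Finset.sum_congr rfl fun φ _ => hcount φ, Finset.sum_const, smul_eq_mul,
    Finset.card_univ, Fintype.card_embedding_eq, hX, Fintype.card_fin]
  calc _ ≤ (d * (q + 1)) ^ (m + 3) * (q + 1) ^ Fintype.card (Sym2 X) :=
        Nat.mul_le_mul_right _ (Nat.descFactorial_le_pow _ _)
    _ = _ := by rw [mul_pow]; ring

theorem two_pow_mul_pow_le_succ_pow {q r a : ℕ} (h : (q + 1) * r ≤ a) :
    2 ^ r * q ^ a ≤ (q + 1) ^ a := by
  have h1 : 2 * q ^ (q + 1) ≤ (q + 1) ^ (q + 1) := by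
    -- These are the first two terms of the binomial expansion of `(q + 1) ^ (q + 1)`.
    have h := Finset.sum_le_sum_of_subset (f := fun m => q ^ m * (q + 1).choose m)
      (show {q, q + 1} ⊆ Finset.range (q + 1 + 1) by simp [Finset.insert_subset_iff])
    rw [Finset.sum_pair (by omega)] at h
    have h' := add_pow q 1 (q + 1)
    simp only [one_pow, mul_one, Nat.cast_id] at h'
    rw [h']
    refine le_trans ?_ h
    simp only [Nat.choose_self, Nat.choose_succ_self_right, pow_succ]
    linarith [Nat.zero_le (q ^ q)]
  obtain ⟨b, rfl⟩ := Nat.exists_eq_add_of_le h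
  rw [pow_add, pow_add, pow_mul, pow_mul, ← mul_assoc, ← mul_pow]
  exact Nat.mul_le_mul (Nat.pow_le_pow_left h1 r) (Nat.pow_le_pow_left q.le_succ b)

/-- The total number of independent sets of size `s` in all labelled graphs. -/
theorem card_indepSets_le (s : ℕ) (hs : (q + 1) * (Fintype.card X + 1) ≤ s.choose 2) :
    2 * ∑ f : Sym2 X → Fin (q + 1), ((Finset.univ : Finset X).powerset.filter fun S =>
        S.card = s ∧ ∀ x ∈ S, ∀ y ∈ S, x ≠ y → f s(x, y) ≠ 0).card ≤
      (q + 1) ^ Fintype.card (Sym2 X) := by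
  have hcount : ∀ S : Finset X,
      (Finset.univ.filter fun f : Sym2 X → Fin (q + 1) =>
        S.card = s ∧ ∀ x ∈ S, ∀ y ∈ S, x ≠ y → f s(x, y) ≠ 0).card * 2 ^ (Fintype.card X + 1) ≤
      (q + 1) ^ Fintype.card (Sym2 X) := by
    intro S
    by_cases hS : S.card = s
    swap
    · simp [hS]
    have h := card_filter_forall_mem_mul_pow (S.offDiag.image (Function.uncurry Sym2.mk))
      ({0}ᶜ : Finset (Fin (q + 1)))
    rw [Sym2.card_image_offDiag, hS, Fintype.card_fin, Finset.card_compl, Finset.card_singleton,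
      Fintype.card_fin, Nat.add_sub_cancel] at h
    have hset : (Finset.univ.filter fun f : Sym2 X → Fin (q + 1) =>
        S.card = s ∧ ∀ x ∈ S, ∀ y ∈ S, x ≠ y → f s(x, y) ≠ 0) =
        Finset.univ.filter fun f : Sym2 X → Fin (q + 1) =>
          ∀ e ∈ S.offDiag.image (Function.uncurry Sym2.mk), f e ∈ ({0}ᶜ : Finset (Fin (q + 1))) := by
      ext f
      simp [hS]
      grind
    rw [hset]
    have h2 := two_pow_mul_pow_le_succ_pow hs
    refine Nat.le_of_mul_le_mul_right (c := (q + 1) ^ s.choose 2) ?_ (by positivity)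
    calc _ = _ * (q + 1) ^ s.choose 2 * 2 ^ (Fintype.card X + 1) := by ring
      _ = 2 ^ (Fintype.card X + 1) * q ^ s.choose 2 * (q + 1) ^ Fintype.card (Sym2 X) := by
        rw [h]; ring
      _ ≤ _ := by rw [mul_comm]; exact Nat.mul_le_mul_left _ h2
  have hswap := Finset.sum_card_bipartiteAbove_eq_sum_card_bipartiteBelow
    (fun (f : Sym2 X → Fin (q + 1)) (S : Finset X) =>
      S.card = s ∧ ∀ x ∈ S, ∀ y ∈ S, x ≠ y → f s(x, y) ≠ 0)
    (s := Finset.univ) (t := Finset.univ.powerset)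
  simp only [Finset.bipartiteAbove, Finset.bipartiteBelow] at hswap
  rw [hswap]
  refine Nat.le_of_mul_le_mul_right (c := 2 ^ Fintype.card X) ?_ (by positivity)
  calc _ = ∑ S ∈ (Finset.univ : Finset X).powerset,
        (Finset.univ.filter fun f : Sym2 X → Fin (q + 1) => S.card = s ∧
          ∀ x ∈ S, ∀ y ∈ S, x ≠ y → f s(x, y) ≠ 0).card * 2 ^ (Fintype.card X + 1) := by
        rw [← Finset.sum_mul]; ring
    _ ≤ ∑ S ∈ (Finset.univ : Finset X).powerset, (q + 1) ^ Fintype.card (Sym2 X) :=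
        Finset.sum_le_sum fun S _ => hcount S
    _ = _ := by
        rw [Finset.sum_const, Finset.card_powerset, Finset.card_univ, smul_eq_mul, mul_comm]

/-- The first moment argument. If labels are drawn uniformly at random, the expected number of
cycles with at most `g + 2` vertices plus `M` times the expected number of independent sets of size
`s` is less than `M`, so that some labelling has fewer than `M` short cycles and no independent set
of size `s`. Deleting a vertex from each short cycle leaves the graph required. -/
theorem exists_cycleGraph_free_indepNum_lt (g d s M : ℕ) (hX : Fintype.card X = d * (q + 1))
    (hM : 2 * ∑ m ∈ Finset.range g, d ^ (m + 3) < M)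
    (hs : (q + 1) * (Fintype.card X + 1) ≤ s.choose 2) :
    ∃ (Y : Set X) (J : SimpleGraph Y), (∀ m < g, (cycleGraph (m + 3)).Free J) ∧
      J.indepNum < s ∧ Fintype.card X < Nat.card Y + M := by
  let cyc (f : Sym2 X → Fin (q + 1)) (m : ℕ) : Finset (Fin (m + 3) ↪ X) :=
    Finset.univ.filter fun φ => ∀ i j, (cycleGraph (m + 3)).Adj i j → f s(φ i, φ j) = 0
  let ind (f : Sym2 X → Fin (q + 1)) : Finset (Finset X) :=
    Finset.univ.powerset.filter fun S =>
      S.card = s ∧ ∀ x ∈ S, ∀ y ∈ S, x ≠ y → f s(x, y) ≠ 0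
  obtain ⟨f, -, hf⟩ : ∃ f ∈ (Finset.univ : Finset (Sym2 X → Fin (q + 1))),
      ∑ m ∈ Finset.range g, (cyc f m).card + M * (ind f).card < M := by
    refine Finset.exists_lt_of_sum_lt ?_
    rw [Finset.sum_add_distrib, Finset.sum_comm, ← Finset.mul_sum, Finset.sum_const,
      Finset.card_univ, Fintype.card_fun, Fintype.card_fin, smul_eq_mul]
    have h1 : ∑ m ∈ Finset.range g, ∑ f, (cyc f m).card ≤
        (∑ m ∈ Finset.range g, d ^ (m + 3)) * (q + 1) ^ Fintype.card (Sym2 X) := by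
      rw [Finset.sum_mul]
      exact Finset.sum_le_sum fun m _ => card_cycleGraph_copies_le d m hX
    have h2 : M * (2 * ∑ f, (ind f).card) ≤ M * (q + 1) ^ Fintype.card (Sym2 X) :=
      Nat.mul_le_mul_left _ (card_indepSets_le s hs)
    have h3 := Nat.mul_lt_mul_of_pos_right hM
      (show 0 < (q + 1) ^ Fintype.card (Sym2 X) by positivity)
    rw [mul_left_comm] at h2
    rw [mul_assoc] at h3
    rw [mul_comm ((q + 1) ^ Fintype.card (Sym2 X)) M]
    omega
  have hind : ind f = ∅ := by
    rw [← Finset.card_eq_zero]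
    by_contra h
    have : M * 1 ≤ M * (ind f).card := Nat.mul_le_mul_left _ (by omega)
    omega
  let D : Finset X := (Finset.range g).biUnion fun m => (cyc f m).image fun φ => φ 0
  have hD : D.card < M := by
    refine lt_of_le_of_lt ?_ hf
    refine (Finset.card_biUnion_le.trans ?_).trans (Nat.le_add_right _ _)
    exact Finset.sum_le_sum fun m _ => Finset.card_image_le
  refine ⟨{x : X | x ∉ D}, (zeroLabelGraph f).induce _, ?_, ?_, ?_⟩
  · rintro m hm ⟨φ⟩
    refine (φ 0).2 (Finset.mem_biUnion.2 ⟨m, Finset.mem_range.2 hm, Finset.mem_image.2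
      ⟨φ.toEmbedding.trans (Function.Embedding.subtype _), ?_, rfl⟩⟩)
    refine Finset.mem_filter.2 ⟨Finset.mem_univ _, fun i j hij => ?_⟩
    exact (zeroLabelGraph_adj.1 (φ.toHom.map_adj hij)).1
  · by_contra! hle
    obtain ⟨S, hS⟩ := ((zeroLabelGraph f).induce {x : X | x ∉ D}).exists_isNIndepSet_indepNum
    obtain ⟨T, hTS, hT⟩ := Finset.exists_subset_card_eq (hle.trans hS.card_eq.ge)
    have hmem : T.map (Function.Embedding.subtype _) ∈ ind f := by
      refine Finset.mem_filter.2 ⟨by simp, by simpa using hT, ?_⟩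
      intro x hx y hy hxy h0
      obtain ⟨x, hx', rfl⟩ := Finset.mem_map.1 hx
      obtain ⟨y, hy', rfl⟩ := Finset.mem_map.1 hy
      exact hS.isIndepSet (hTS hx') (hTS hy') (fun h => hxy (congrArg _ h))
        (zeroLabelGraph_adj.2 ⟨h0, hxy⟩)
    exact Finset.notMem_empty _ (hind ▸ hmem)
  · have hcard : Nat.card {x : X | x ∉ D} = Dᶜ.card :=
      Nat.subtype_card Dᶜ (by simp)
    have := Finset.card_add_card_compl D
    omega

end RandomGraph

/-- Erdős's theorem on sparse graphs: there are graphs without cycles of length at most `g + 2`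
in which every independent set contains less than a fraction `1 / C` of the vertices. -/
theorem exists_cycleGraph_free_mul_indepNum_lt (g C : ℕ) (hC : 1 ≤ C) :
    ∃ (n : ℕ) (Y : Set (Fin n)) (J : SimpleGraph Y),
      (∀ m < g, (cycleGraph (m + 3)).Free J) ∧ C * J.indepNum < Nat.card Y := by
  -- The average degree is about `d`. Independent sets of size `k * (q + 1)` are excluded, and at
  -- least half of the `2 * C * k * (q + 1)` vertices survive the deletion.
  obtain ⟨k, hk⟩ : ∃ k, k = 4 * C + 2 := ⟨_, rfl⟩
  obtain ⟨d, hd⟩ : ∃ d, d = 2 * C * k := ⟨_, rfl⟩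
  obtain ⟨q, hq⟩ : ∃ q, q = 2 * ∑ m ∈ Finset.range g, d ^ (m + 3) := ⟨_, rfl⟩
  obtain ⟨M, hM⟩ : ∃ M, M = C * (k * (q + 1)) := ⟨_, rfl⟩
  have hqM : q < M := by
    rw [hM]
    calc q < 1 * (1 * (q + 1)) := by omega
      _ ≤ _ := by gcongr; omega
  have hchoose : (q + 1) * (d * (q + 1) + 1) ≤ (k * (q + 1)).choose 2 := by
    rw [Nat.choose_two_right, Nat.le_div_iff_mul_le (by norm_num), hd]
    obtain ⟨t, ht⟩ : ∃ t, k * (q + 1) = t + 1 :=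
      Nat.exists_eq_succ_of_ne_zero (by rw [hk]; positivity)
    have : 2 * (2 * C * k * (q + 1) + 1) ≤ k * t := by
      zify at ht hk ⊢
      have h1 : (0 : ℤ) ≤ k * q := by positivity
      have h3 : (k : ℤ) * t - 2 * (2 * C * k * (q + 1) + 1) = 2 * (k * q) + k - 2 := by
        rw [show (t : ℤ) = k * (q + 1) - 1 by linarith, hk]; ring
      omega
    rw [ht, Nat.add_sub_cancel, ← ht]
    calc _ = (q + 1) * (2 * (2 * C * k * (q + 1) + 1)) := by ring
      _ ≤ (q + 1) * (k * t) := Nat.mul_le_mul_left _ this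
      _ = _ := by ring
  obtain ⟨Y, J, hJ, hind, hY⟩ := exists_cycleGraph_free_indepNum_lt (X := Fin (d * (q + 1)))
    g d (k * (q + 1)) M (Fintype.card_fin _) (hq ▸ hqM) (by rwa [Fintype.card_fin])
  refine ⟨_, Y, J, hJ, ?_⟩
  have h1 : C * J.indepNum ≤ M := by
    rw [hM]; exact Nat.mul_le_mul_left _ hind.le
  have h2 : d * (q + 1) = 2 * M := by rw [hM, hd]; ring
  rw [Fintype.card_fin] at hY
  omega

end SimpleGraph

open SimpleGraph

/-! ### Chromatic and clique numbers of finite graphs -/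

namespace FinGraph

theorem chi_le_of_colorable {G : FinGraph} {n : ℕ} (h : G.graph.Colorable n) : G.chi ≤ n := by
  have := chromaticNumber_le_iff_colorable.2 h
  rw [← G.coe_chi] at this
  exact_mod_cast this

theorem card_le_chi_mul_indepNum (G : FinGraph) : Nat.card G.V ≤ G.chi * G.graph.indepNum :=
  (chromaticNumber_le_iff_colorable.1 G.coe_chi.ge).card_le_mul_indepNum

theorem chi_le_card (G : FinGraph) : G.chi ≤ Nat.card G.V := by
  have := Fintype.ofFinite G.V
  rw [Nat.card_eq_fintype_card]
  exact chi_le_of_colorable G.graph.colorable_of_fintype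

end FinGraph

/-! ### Graphs with independence number at most two -/

/-- The class of finite graphs in which no three vertices are independent. -/
def indepNumLeTwoClass : Set FinGraph := {G | G.graphᶜ.CliqueFree 3}

theorem isHereditary_indepNumLeTwoClass : IsHereditary indepNumLeTwoClass := fun _ hG _ hF =>
  CliqueFree.comap (compl_isIndContained_compl.2 hF).isContained hG

theorem isChiBounded_indepNumLeTwoClass : IsChiBounded indepNumLeTwoClass := by
  refine ⟨fun n => ((n + n * n : ℕ) : ℝ≥0), fun G hG => ?_⟩
  have h := G.chi_le_card.trans (CliqueFree.card_le_indepNum_add_sq hG)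
  rw [indepNum_compl] at h
  exact Nat.cast_le.2 h

/-- If the complement of `H` contains a cycle, then the complements of graphs of large girth are
`H`-free, and those with a small independence number defeat every linear bound. -/
theorem isAcyclic_compl_of_isLinearlyChiBounded {W : Type*} {H : SimpleGraph W}
    (h : IsLinearlyChiBounded (freeSubclass H indepNumLeTwoClass)) : Hᶜ.IsAcyclic := by
  rw [isAcyclic_iff_free_cycleGraph]
  intro m hm hcyc
  obtain ⟨m, rfl⟩ := Nat.exists_eq_add_of_le' hm
  obtain ⟨C, hC1, hC⟩ := h
  obtain ⟨c, hc⟩ := exists_nat_ge C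
  have hc1 : 1 ≤ c := by exact_mod_cast hC1.trans hc
  obtain ⟨n, Y, J, hJ, hlt⟩ := exists_cycleGraph_free_mul_indepNum_lt (m + 1) (2 * c) (by omega)
  have hJ3 : J.CliqueFree 3 := by
    have h3 := hJ 0 (by omega)
    rw [zero_add, cycleGraph_three_eq_top] at h3
    exact cliqueFree_iff_top_free.2 h3
  let G : FinGraph := ⟨Y, Jᶜ⟩
  have hG : G ∈ freeSubclass H indepNumLeTwoClass := by
    refine ⟨?_, fun hHG => ?_⟩
    · change Jᶜᶜ.CliqueFree 3
      rwa [compl_compl]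
    · refine hJ m (by omega) (IsContained.trans hcyc ?_)
      have := (compl_isIndContained_compl.2 hHG).isContained
      rwa [show G.graphᶜ = J from compl_compl J] at this
  have h1 : G.chi ≤ c * G.omega := by
    have h := (hC G hG).trans (mul_le_mul_left hc _)
    exact_mod_cast h
  have h2 : Nat.card Y ≤ G.chi * 2 := by
    refine G.card_le_chi_mul_indepNum.trans (Nat.mul_le_mul_left _ ?_)
    obtain ⟨s, hs⟩ := J.exists_isNClique_cliqueNum
    change Jᶜ.indepNum ≤ 2
    rw [indepNum_compl]
    by_contra! hlt
    exact hJ3.mono hlt s hs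
  have h3 : G.omega = J.indepNum := cliqueNum_compl
  rw [h3] at h1
  have h4 := Nat.mul_le_mul_right 2 h1
  rw [mul_assoc] at hlt
  omega

/-! ### Lexicographic powers of the five-cycle -/

/-- The iterated lexicographic powers of the five-cycle. -/
def cycleFiveLexPow : ℕ → FinGraph
  | 0 => ⟨Unit, ⊥⟩
  | k + 1 => ⟨Fin 5 × (cycleFiveLexPow k).V, (cycleGraph 5).lexProd (cycleFiveLexPow k).graph⟩

theorem cycleGraph_five_cliqueFree : (cycleGraph 5).CliqueFree 3 := by
  unfold CliqueFree
  simp only [isNClique_iff, IsClique, Set.Pairwise]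
  decide

theorem cycleGraph_five_indepSetFree : (cycleGraph 5).IndepSetFree 3 := by
  unfold IndepSetFree
  simp only [isNIndepSet_iff, IsIndepSet, Set.Pairwise]
  decide

theorem SimpleGraph.cliqueNum_le_card {V : Type*} [Finite V] (G : SimpleGraph V) :
    G.cliqueNum ≤ Nat.card V := by
  have := Fintype.ofFinite V
  obtain ⟨s, hs⟩ := G.exists_isNClique_cliqueNum
  rw [← hs.card_eq, Nat.card_eq_fintype_card]
  exact s.card_le_univ

theorem card_cycleFiveLexPow (k : ℕ) : Nat.card (cycleFiveLexPow k).V = 5 ^ k := by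
  induction k with
  | zero => exact Nat.card_unique (α := Unit)
  | succ k ih =>
    change Nat.card (Fin 5 × (cycleFiveLexPow k).V) = _
    rw [Nat.card_prod, ih, Nat.card_fin, pow_succ, mul_comm]

theorem omega_cycleFiveLexPow_le (k : ℕ) : (cycleFiveLexPow k).omega ≤ 2 ^ k := by
  induction k with
  | zero => exact (SimpleGraph.cliqueNum_le_card _).trans (card_cycleFiveLexPow 0).le
  | succ k ih =>
    rw [pow_succ, mul_comm]
    refine (cliqueNum_lexProd_le _ _).trans (Nat.mul_le_mul ?_ ih)
    obtain ⟨s, hs⟩ := (cycleGraph 5).exists_isNClique_cliqueNum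
    by_contra! hlt
    exact cycleGraph_five_cliqueFree.mono hlt s hs

theorem indepNum_cycleFiveLexPow_le (k : ℕ) : (cycleFiveLexPow k).graph.indepNum ≤ 2 ^ k := by
  induction k with
  | zero =>
    rw [← cliqueNum_compl]
    exact (SimpleGraph.cliqueNum_le_card _).trans (card_cycleFiveLexPow 0).le
  | succ k ih =>
    rw [pow_succ, mul_comm]
    refine (indepNum_lexProd_le _ _).trans (Nat.mul_le_mul ?_ ih)
    rw [← cliqueNum_compl]
    obtain ⟨s, hs⟩ := (cycleGraph 5)ᶜ.exists_isNClique_cliqueNum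
    by_contra! hlt
    exact ((cliqueFree_compl _).2 cycleGraph_five_indepSetFree).mono hlt s hs

/-- Both graphs have five vertices, but an end vertex of the path has only one neighbour. -/
theorem not_pathGraph_five_isIndContained_compl_cycleGraph :
    ¬ pathGraph 5 ⊴ (cycleGraph 5)ᶜ := by
  rintro ⟨f⟩
  have hsurj : Function.Surjective f := Finite.surjective_of_injective f.injective
  have hnbr : ∀ v : Fin 5, ∃ x y, x ≠ y ∧ (cycleGraph 5)ᶜ.Adj v x ∧ (cycleGraph 5)ᶜ.Adj v y := by
    decide
  have hend : ∀ i j : Fin 5, (pathGraph 5).Adj 0 i → (pathGraph 5).Adj 0 j → i = j := by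
    simp only [pathGraph_adj]
    decide
  obtain ⟨x, y, hxy, hx, hy⟩ := hnbr (f 0)
  obtain ⟨i, rfl⟩ := hsurj x
  obtain ⟨j, rfl⟩ := hsurj y
  exact hxy (congrArg f (hend i j (f.map_adj_iff.1 hx) (f.map_adj_iff.1 hy)))

theorem not_pathGraph_five_isIndContained_compl_cycleFiveLexPow (k : ℕ) :
    ¬ pathGraph 5 ⊴ (cycleFiveLexPow k).graphᶜ := by
  induction k with
  | zero =>
    rintro ⟨f⟩
    exact absurd (f.injective (Subsingleton.elim (α := Unit) (f 0) (f 1))) (by decide)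
  | succ k ih =>
    intro h
    change pathGraph 5 ⊴ ((cycleGraph 5).lexProd (cycleFiveLexPow k).graph)ᶜ at h
    rw [compl_lexProd] at h
    exact (pathGraph_five_isIndContained_of_lexProd h).elim
      not_pathGraph_five_isIndContained_compl_cycleGraph ih

theorem cycleFiveLexPow_colorable_of_cliqueFreeOn (k : ℕ) :
    ∀ (s : Set (cycleFiveLexPow k).V) (n : ℕ),
      (cycleFiveLexPow k).graph.CliqueFreeOn s (n + 1) →
      ∃ c : (cycleFiveLexPow k).V → Fin (3 ^ n),
        ∀ x ∈ s, ∀ y ∈ s, (cycleFiveLexPow k).graph.Adj x y → c x ≠ c y := by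
  induction k with
  | zero => exact fun s n _ => ⟨fun _ => ⟨0, by positivity⟩, fun x _ y _ h => h.elim⟩
  | succ k ih => exact colorable_lexProd_of_cliqueFreeOn ⟨cycleGraph.tricoloring 5 (by norm_num)⟩ ih

/-- The class of induced subgraphs of lexicographic powers of the five-cycle. -/
def cycleFiveLexPowClass : Set FinGraph := {F | ∃ k, F.graph ⊴ (cycleFiveLexPow k).graph}

theorem isHereditary_cycleFiveLexPowClass : IsHereditary cycleFiveLexPowClass :=
  fun _ ⟨k, hk⟩ _ hF => ⟨k, hF.trans hk⟩

theorem isChiBounded_cycleFiveLexPowClass : IsChiBounded cycleFiveLexPowClass := by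
  refine ⟨fun n => ((3 ^ n : ℕ) : ℝ≥0), ?_⟩
  rintro F ⟨k, ⟨f⟩⟩
  obtain ⟨c, hc⟩ := cycleFiveLexPow_colorable_of_cliqueFreeOn k (Set.range f) F.omega (by
    have := Fintype.ofFinite F.V
    classical
    intro t ht hclique
    have hmap : (Finset.univ.filter fun v => f v ∈ t).map f.toEmbedding = t := by
      ext x
      simp only [Finset.mem_map, Finset.mem_filter, Finset.mem_univ, true_and]
      constructor
      · rintro ⟨v, hv, rfl⟩
        exact hv
      · intro hx
        obtain ⟨v, rfl⟩ := ht hx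
        exact ⟨v, hx, rfl⟩
    have hle : (Finset.univ.filter fun v => f v ∈ t).card ≤ F.omega := by
      refine IsClique.card_le_cliqueNum (tc := ?_)
      intro u hu v hv huv
      simp only [Finset.coe_filter, Finset.mem_univ, true_and] at hu hv
      exact f.map_adj_iff.1 (hclique.isClique hu hv (f.injective.ne huv))
    have := hclique.card_eq
    rw [← hmap, Finset.card_map] at this
    omega)
  have hcol : F.graph.Colorable (3 ^ F.omega) :=
    ⟨Coloring.mk (fun v => c (f v)) fun {u v} huv =>
      hc _ ⟨u, rfl⟩ _ ⟨v, rfl⟩ (f.map_adj_iff.2 huv)⟩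
  exact Nat.cast_le.2 (FinGraph.chi_le_of_colorable hcol)

/-- If the complement of `H` has an induced path on five vertices, then all lexicographic powers of
the five-cycle are `H`-free, while the `k`-th one has `χ ≥ (5 / 2) ^ k` and `ω ≤ 2 ^ k`. -/
theorem isFreeOf_pathGraph_five_compl_of_isLinearlyChiBounded {W : Type*} {H : SimpleGraph W}
    (h : IsLinearlyChiBounded (freeSubclass H cycleFiveLexPowClass)) :
    IsFreeOf (pathGraph 5) Hᶜ := by
  intro hP
  obtain ⟨C, -, hC⟩ := h
  obtain ⟨c, hc⟩ := exists_nat_ge C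
  have hbound : ∀ k, 5 ^ k ≤ c * 4 ^ k := by
    intro k
    have hmem : cycleFiveLexPow k ∈ freeSubclass H cycleFiveLexPowClass :=
      ⟨⟨k, .rfl⟩, fun hH => not_pathGraph_five_isIndContained_compl_cycleFiveLexPow k
        (hP.trans (compl_isIndContained_compl.2 hH))⟩
    have h1 : (cycleFiveLexPow k).chi ≤ c * (cycleFiveLexPow k).omega := by
      have h := (hC _ hmem).trans (mul_le_mul_left hc _)
      exact_mod_cast h
    calc 5 ^ k = Nat.card (cycleFiveLexPow k).V := (card_cycleFiveLexPow k).symm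
      _ ≤ (cycleFiveLexPow k).chi * (cycleFiveLexPow k).graph.indepNum :=
        FinGraph.card_le_chi_mul_indepNum _
      _ ≤ (c * 2 ^ k) * 2 ^ k :=
        Nat.mul_le_mul (h1.trans (Nat.mul_le_mul_left _ (omega_cycleFiveLexPow_le k)))
          (indepNum_cycleFiveLexPow_le k)
      _ = c * 4 ^ k := by rw [mul_assoc, ← mul_pow]; norm_num
  obtain ⟨k, hk⟩ := pow_unbounded_of_one_lt (c : ℝ) (show (1 : ℝ) < 5 / 4 by norm_num)
  rw [div_pow, lt_div_iff₀ (by positivity)] at hk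
  exact absurd (hbound k) (not_le.2 (by exact_mod_cast hk))

theorem mainTheorem11 {W : Type*} [Finite W] (H : SimpleGraph W)
    (hH : ∀ 𝒢 : Set FinGraph, IsHereditary 𝒢 → IsChiBounded 𝒢 →
      IsLinearlyChiBounded (freeSubclass H 𝒢)) :
    Hᶜ.IsAcyclic ∧ IsFreeOf (SimpleGraph.pathGraph 5) Hᶜ :=
  ⟨isAcyclic_compl_of_isLinearlyChiBounded
      (hH _ isHereditary_indepNumLeTwoClass isChiBounded_indepNumLeTwoClass),
    isFreeOf_pathGraph_five_compl_of_isLinearlyChiBounded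
      (hH _ isHereditary_cycleFiveLexPowClass isChiBounded_cycleFiveLexPowClass)⟩
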